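/- Fix a prime $p$. A $\delta$-ring is a commutative ring $A$ with a map $\delta : A \to A$ such that $\delta(1)=0$, $\delta(xy)=x^p\delta(y)+\delta(x)y^p+p\,\delta(x)\delta(y)$ and $\delta(x+y)=\delta(x)+\delta(y)+\frac{x^p+y^p-(x+y)^p}{p}$ (the last term being the value of a polynomial with integer coefficients); its Frobenius lift is the ring endomorphism $\varphi(x)=x^p+p\,\delta(x)$, and a $\delta$-ring map is a ring map commuting with $\delta$. "$p$-complete" and $(-)^\wedge$ refer to classical $p$-adic completeness and completion. A $\delta$-ring is called Stone if it is isomorphic, as a $\delta$-ring, to the ring $W(R)$ of $p$-typical Witt vectors of an $\mathbb{F}_p$-algebra $R$ in which $a^p=a$ for all $a\in R$ (with the $\delta$-structure on $W(R)$ whose Frobenius lift is the Witt vector Frobenius). A ring map $A\to B$ is $p$-completely faithfully flat if $\mathrm{Tor}_i^A(B,A/p)=0$ for all $i>0$ and the induced map $A/p\to B/p$ is faithfully flat. Proposition. Let $A$ be a $p$-complete $\delta$-ring with Frobenius lift $\varphi$. Let $\mathrm{coker}(\varphi-1)$ be the cokernel in the category of commutative rings (the coequalizer of $\varphi$ and $\mathrm{id}_A$),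 that is, the quotient of $A$ by the ideal generated by all $\varphi(x)-x$, and put $A^\wedge_{\varphi=1}=\mathrm{coker}(\varphi-1)^\wedge$, with canonical map $\eta: A\to A^\wedge_{\varphi=1}$. Then: (1) $A^\wedge_{\varphi=1}$ carries a $\delta$-structure for which it is a Stone $\delta$-ring and $\eta$ is the universal $\delta$-ring map from $A$ to a Stone $\delta$-ring; that is, $A^\wedge_{\varphi=1}$ is the value at $A$ of the left adjoint of the inclusion of Stone $\delta$-rings into $p$-complete $\delta$-rings. (2) $A$ is a Stone $\delta$-ring if and only if $\eta: A\to A^\wedge_{\varphi=1}$ is $p$-completely faithfully flat. -/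

import Mathlib

universe u

open CategoryTheory

/-- The value of the integral polynomial `(X ^ p + Y ^ p - (X + Y) ^ p) / p` at `(x, y)`; for `p`
prime and `0 < i < p` the binomial coefficient `p.choose i` is divisible by `p`, so the division of
natural numbers below is exact. -/
def deltaCross (p : ℕ) {A : Type*} [CommRing A] (x y : A) : A :=
  -∑ i ∈ Finset.Ioo 0 p, ((p.choose i / p : ℕ) : A) * x ^ i * y ^ (p - i)

theorem natCast_mul_deltaCross (p : ℕ) [hp : Fact p.Prime] {A : Type*} [CommRing A] (x y : A) :
    (p : A) * deltaCross p x y = x ^ p + y ^ p - (x + y) ^ p := by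
  have hpos : 0 < p := hp.out.pos
  have key : (x + y) ^ p = x ^ p + y ^ p
      + ∑ i ∈ Finset.Ioo 0 p, (p : A) * (((p.choose i / p : ℕ) : A) * x ^ i * y ^ (p - i)) := by
    rw [add_pow, Finset.sum_range_succ, Finset.range_eq_Ico,
      Finset.sum_eq_sum_Ico_succ_bot hpos]
    have hs : Finset.Ioo 0 p = Finset.Ico (0 + 1) p := by
      ext i
      simp [Nat.succ_le_iff]
    rw [hs]
    have h2 : ∀ i ∈ Finset.Ico (0 + 1) p, x ^ i * y ^ (p - i) * ((p.choose i : ℕ) : A)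
        = (p : A) * (((p.choose i / p : ℕ) : A) * x ^ i * y ^ (p - i)) := by
      intro i hi
      rw [Finset.mem_Ico] at hi
      have hd : p ∣ p.choose i := hp.out.dvd_choose_self (by omega) hi.2
      have hc : ((p.choose i : ℕ) : A) = (p : A) * ((p.choose i / p : ℕ) : A) := by
        rw [← Nat.cast_mul, Nat.mul_div_cancel' hd]
      rw [hc]
      ring
    rw [Finset.sum_congr rfl h2]
    simp
    ring
  rw [key, ← Finset.mul_sum, deltaCross]
  ring

/-- A `δ`-ring structure (for the prime `p`) on a commutative ring `A`. -/
structure DeltaStructure (p : ℕ) (A : Type*) [CommRing A] where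
  δ : A → A
  δ_one : δ 1 = 0
  δ_mul : ∀ x y : A, δ (x * y) = x ^ p * δ y + δ x * y ^ p + (p : A) * δ x * δ y
  δ_add : ∀ x y : A, δ (x + y) = δ x + δ y + deltaCross p x y

namespace DeltaStructure

/-- The Frobenius lift `φ(x) = x ^ p + p δ(x)`, a ring endomorphism. -/
def frobeniusLift {p : ℕ} [hp : Fact p.Prime] {A : Type*} [CommRing A]
    (d : DeltaStructure p A) : A →+* A where
  toFun x := x ^ p + (p : A) * d.δ x
  map_one' := by simp [d.δ_one]
  map_mul' x y := by
    rw [d.δ_mul]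
    ring
  map_zero' := by
    have h0 : d.δ 0 = 0 := by
      have h := d.δ_add 0 0
      have hc : deltaCross p (0 : A) 0 = 0 := by
        rw [deltaCross, neg_eq_zero]
        refine Finset.sum_eq_zero fun i hi => ?_
        rw [Finset.mem_Ioo] at hi
        rw [zero_pow (by omega : i ≠ 0)]
        simp
      rw [hc, add_zero, add_zero] at h
      simpa using h
    rw [h0, zero_pow hp.out.ne_zero]
    simp
  map_add' x y := by
    rw [d.δ_add]
    have h := natCast_mul_deltaCross p x y
    linear_combination h

/-- A ring map commuting with the `δ`-structures. -/
def IsDeltaHom {p : ℕ} {A B : Type*} [CommRing A] [CommRing B]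
    (dA : DeltaStructure p A) (dB : DeltaStructure p B) (f : A →+* B) : Prop :=
  ∀ x : A, f (dA.δ x) = dB.δ (f x)

/-- On a `p`-torsion-free ring, a ring endomorphism `φ` lifting the Frobenius modulo `p`
gives the `δ`-structure `δ(x) = (φ(x) - x ^ p) / p`. -/
noncomputable def ofFrobeniusLift (p : ℕ) [hp : Fact p.Prime] {A : Type*} [CommRing A]
    (htf : ∀ x : A, (p : A) * x = 0 → x = 0) (φ : A →+* A)
    (hφ : ∀ x : A, (p : A) ∣ φ x - x ^ p) : DeltaStructure p A :=
  have spec (x : A) : φ x - x ^ p = (p : A) * (hφ x).choose := (hφ x).choose_spec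
  have inj (a b : A) (h : (p : A) * a = (p : A) * b) : a = b :=
    sub_eq_zero.mp (htf _ (by rw [mul_sub, h, sub_self]))
  { δ := fun x => (hφ x).choose
    δ_one := inj _ _ (by rw [← spec]; simp)
    δ_mul := fun x y => inj _ _ (by
      linear_combination φ.map_mul x y - spec (x * y) + φ y * spec x
        + (x ^ p + (p : A) * (hφ x).choose) * spec y)
    δ_add := fun x y => inj _ _ (by
      linear_combination φ.map_add x y - spec (x + y) + spec x + spec y
        - natCast_mul_deltaCross p x y) }

end DeltaStructure

/-- A `p`-Boolean algebra: an `𝔽_p`-algebra (a commutative ring with `p = 0`) in which every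
element satisfies `a ^ p = a`. -/
structure IsPBoolean (p : ℕ) (R : Type*) [CommRing R] : Prop where
  natCast_eq_zero : (p : R) = 0
  pow_eq : ∀ a : R, a ^ p = a

namespace IsPBoolean

/-- A nonzero `p`-Boolean algebra has characteristic `p` and is perfect. -/
theorem charP_and_perfectRing {p : ℕ} [hp : Fact p.Prime] {R : Type*} [CommRing R]
    [Nontrivial R] (hR : IsPBoolean p R) : ∃ _ : CharP R p, PerfectRing R p := by
  have hc : CharP R p := by
    obtain ⟨q, hq⟩ := CharP.exists R
    have hdvd : q ∣ p := (CharP.cast_eq_zero_iff R q p).mp hR.natCast_eq_zero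
    rcases (Nat.dvd_prime hp.out).mp hdvd with h | h
    · exact absurd h (CharP.char_ne_one R q)
    · exact h ▸ hq
  refine ⟨hc, ⟨?_⟩⟩
  have hid : (fun a : R => a ^ p) = id := funext fun a => hR.pow_eq a
  rw [hid]
  exact Function.bijective_id

theorem witt_torsionFree {p : ℕ} [hp : Fact p.Prime] {R : Type*} [CommRing R]
    (hR : IsPBoolean p R) (x : WittVector p R) (hx : (p : WittVector p R) * x = 0) : x = 0 := by
  rcases subsingleton_or_nontrivial R with h | h
  · exact WittVector.ext fun n => Subsingleton.elim _ _
  · obtain ⟨_, _⟩ := hR.charP_and_perfectRing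
    exact WittVector.eq_zero_of_p_mul_eq_zero x (by rw [mul_comm, hx])

theorem witt_frobenius_dvd {p : ℕ} [hp : Fact p.Prime] {R : Type*} [CommRing R]
    (hR : IsPBoolean p R) (x : WittVector p R) :
    (p : WittVector p R) ∣ WittVector.frobenius x - x ^ p := by
  rcases subsingleton_or_nontrivial R with h | h
  · have h0 : WittVector.frobenius x - x ^ p = 0 :=
      WittVector.ext fun n => Subsingleton.elim _ _
    rw [h0]
    exact dvd_zero _
  · obtain ⟨_, _⟩ := hR.charP_and_perfectRing
    rw [← Ideal.mem_span_singleton, WittVector.mem_span_p_iff_coeff_zero_eq_zero]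
    change (WittVector.constantCoeff : WittVector p R →+* R) (WittVector.frobenius x - x ^ p) = 0
    rw [map_sub, map_pow]
    change (WittVector.frobenius x).coeff 0 - x.coeff 0 ^ p = 0
    rw [WittVector.coeff_frobenius_charP, sub_self]

/-- The `δ`-structure of the ring `W(R)` of `p`-typical Witt vectors of a `p`-Boolean algebra `R`:
the one whose Frobenius lift is the Witt vector Frobenius. -/
noncomputable def wittDelta {p : ℕ} [Fact p.Prime] {R : Type*} [CommRing R]
    (hR : IsPBoolean p R) : DeltaStructure p (WittVector p R) :=
  DeltaStructure.ofFrobeniusLift p hR.witt_torsionFree WittVector.frobenius hR.witt_frobenius_dvd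

end IsPBoolean

/-- Let `f : A → B` be a ring map and `I` an ideal of `A` (finitely generated in applications).
`f` is `I`-completely faithfully flat if the derived tensor product of `B` and `A / I` over `A` is
concentrated in degree `0`, that is `Tor_i^A(B, A / I) = 0` for all `i > 0`, and the induced map
`A / I → B / I B` is faithfully flat. -/
def IsCompletelyFaithfullyFlat {A B : Type u} [CommRing A] [CommRing B] (I : Ideal A)
    (f : A →+* B) : Prop :=
  letI : Algebra A B := f.toAlgebra
  (∀ i : ℕ, 0 < i →
    Limits.IsZero (((Tor (ModuleCat.{u} A) i).obj (ModuleCat.of A B)).obj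
      (ModuleCat.of A (A ⧸ I)))) ∧
  (Ideal.quotientMap (I.map f) f Ideal.le_comap_map).FaithfullyFlat

namespace DeltaStructure

/-- `A` is a Stone `δ`-ring if it is isomorphic, as a `δ`-ring, to `W(R)` for some `p`-Boolean
algebra `R`. -/
def IsStone {p : ℕ} [Fact p.Prime] {A : Type u} [CommRing A] (d : DeltaStructure p A) : Prop :=
  ∃ (R : Type u) (_ : CommRing R) (hR : IsPBoolean p R) (e : A ≃+* WittVector p R),
    IsDeltaHom d hR.wittDelta e.toRingHom

/-- The cokernel, in commutative rings, of `φ - 1 : A → A` (the coequalizer of `φ` and the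
identity): the quotient of `A` by the ideal generated by the elements `φ(x) - x`. -/
abbrev Coker {p : ℕ} [Fact p.Prime] {A : Type u} [CommRing A] (d : DeltaStructure p A) : Type u :=
  A ⧸ Ideal.span (Set.range fun x : A => d.frobeniusLift x - x)

/-- The completed `δ`-coinvariants: the classical `p`-completion of the cokernel of `φ - 1`. -/
abbrev Coinvariants {p : ℕ} [Fact p.Prime] {A : Type u} [CommRing A] (d : DeltaStructure p A) :
    Type u :=
  AdicCompletion (Ideal.span {(p : d.Coker)}) d.Coker

/-- The canonical map from `A` to its completed `δ`-coinvariants. -/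
noncomputable def toCoinvariants {p : ℕ} [Fact p.Prime] {A : Type u} [CommRing A]
    (d : DeltaStructure p A) : A →+* d.Coinvariants :=
  (algebraMap d.Coker d.Coinvariants).comp (Ideal.Quotient.mk _)

/-- `η : A → B` exhibits the `δ`-ring `B` as the value at `A` of the left adjoint of the inclusion
of Stone `δ`-rings into `p`-complete `δ`-rings: `B` is Stone and `η` is the universal `δ`-ring map
from `A` to a Stone `δ`-ring. (Ring maps are automatically `p`-adically continuous.) -/
structure IsStoneReflection {p : ℕ} [Fact p.Prime] {A B : Type u} [CommRing A] [CommRing B]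
    (dA : DeltaStructure p A) (dB : DeltaStructure p B) (η : A →+* B) : Prop where
  stone : dB.IsStone
  isDeltaHom : IsDeltaHom dA dB η
  existsUnique : ∀ (C : Type u) [CommRing C] (dC : DeltaStructure p C), dC.IsStone →
    ∀ f : A →+* C, IsDeltaHom dA dC f →
      ∃! g : B →+* C, IsDeltaHom dB dC g ∧ g.comp η = f

end DeltaStructure

/-! Stone `δ`-rings are exactly the `p`-complete, `p`-torsion-free `δ`-rings with `φ = 1`
(`isStone_of_torsionFree` and the `IsStone` lemmas). If `φ = 1`, then `x ^ p ≡ x` mod `p`, so `B /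
p` is `p`-Boolean; Dwork's lemma for constant ghost sequences gives `B → W(B) → W(B / p)`, which is
an isomorphism because it is one modulo `p`.

The crux is that `coker (φ - 1)` is already `p`-torsion-free (`coker_torsionFree`). The ideal `J`
generated by all `φ(x) - x` is `δ`-stable because `δ` commutes with `φ`; if `p x ∈ J`, then `δ(p x)
= φ(x) - p ^ (p - 1) x ^ p` lies in `J`, hence so do `φ(x)` and `x`. Completion preserves this, so
the coinvariants are Stone, and universality follows since `φ = 1` on every Stone ring.

For (2), universality makes `η` bijective when `A` is Stone. Conversely `η` is always surjective,
being so modulo `p`; faithful flatness makes it injective modulo `p`, and since the target is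
torsion-free its kernel is `p`-divisible, hence zero. -/

/-! ### Calculus of `δ` -/

theorem map_deltaCross (p : ℕ) {A B : Type*} [CommRing A] [CommRing B] (f : A →+* B) (x y : A) :
    f (deltaCross p x y) = deltaCross p (f x) (f y) := by
  simp [deltaCross]

theorem deltaCross_mem (p : ℕ) {A : Type*} [CommRing A] (I : Ideal A) {x : A} (hx : x ∈ I)
    (y : A) : deltaCross p x y ∈ I := by
  refine I.neg_mem (I.sum_mem fun i hi => I.mul_mem_right _ (I.mul_mem_left _ ?_))
  exact I.pow_mem_of_mem hx i (Finset.mem_Ioo.mp hi).1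

/-- The integral identity `((a + p y) ^ p - a ^ p) / p + (a ^ p + (p y) ^ p - (a + p y) ^ p) / p =
p ^ (p - 1) y ^ p`, valid in every commutative ring. -/
theorem mul_geom_sum₂_add_deltaCross (p : ℕ) [hp : Fact p.Prime] {A : Type*} [CommRing A]
    (a y : A) :
    y * (∑ i ∈ Finset.range p, (a + p * y) ^ i * a ^ (p - 1 - i)) + deltaCross p a (p * y)
      = (p : A) ^ (p - 1) * y ^ p := by
  -- The universal case, where `p` can be cancelled.
  have key : ∀ s t : MvPolynomial (Fin 2) ℤ,
      t * (∑ i ∈ Finset.range p, (s + p * t) ^ i * s ^ (p - 1 - i)) + deltaCross p s (p * t)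
        = (p : MvPolynomial (Fin 2) ℤ) ^ (p - 1) * t ^ p := by
    intro s t
    have hp0 : (p : MvPolynomial (Fin 2) ℤ) ≠ 0 := Nat.cast_ne_zero.mpr hp.out.ne_zero
    apply mul_left_cancel₀ hp0
    have h1 := (Commute.all (s + p * t) s).geom_sum₂_mul p
    have h2 := natCast_mul_deltaCross p s (p * t)
    have h3 : (p : MvPolynomial (Fin 2) ℤ) * (p : MvPolynomial (Fin 2) ℤ) ^ (p - 1)
        = (p : MvPolynomial (Fin 2) ℤ) ^ p := mul_pow_sub_one hp.out.ne_zero _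
    rw [mul_pow, ← h3] at h2
    linear_combination h1 + h2
  have h := congrArg (MvPolynomial.eval₂Hom (Int.castRingHom A) ![a, y])
    (key (MvPolynomial.X 0) (MvPolynomial.X 1))
  rw [map_add, map_deltaCross] at h
  simpa using h

namespace DeltaStructure

theorem δ_zero {p : ℕ} {A : Type*} [CommRing A] (d : DeltaStructure p A) : d.δ 0 = 0 := by
  have h := d.δ_add 0 0
  have hc : deltaCross p (0 : A) 0 = 0 := by
    simpa using deltaCross_mem p (⊥ : Ideal A) (x := 0) (by simp) 0
  rw [hc, add_zero, add_zero] at h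
  simpa using h

/-- This is `(φ(x) ^ n - (x ^ p) ^ n) / p`, with the division carried out by a geometric sum so that
torsion does no harm. -/
theorem δ_pow {p : ℕ} {A : Type*} [CommRing A] (d : DeltaStructure p A) (x : A) (n : ℕ) :
    d.δ (x ^ n) = d.δ x *
      ∑ i ∈ Finset.range n, (x ^ p + p * d.δ x) ^ i * (x ^ p) ^ (n - 1 - i) := by
  induction n with
  | zero => simp [d.δ_one]
  | succ n ih =>
    rw [pow_succ, d.δ_mul, ih, (Commute.all (x ^ p + p * d.δ x) (x ^ p)).geom_sum₂_comm,
      (Commute.all (x ^ p + p * d.δ x) (x ^ p)).geom_sum₂_comm,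
      add_tsub_cancel_right, geom_sum₂_succ_eq]
    ring

variable {p : ℕ} [hp : Fact p.Prime] {A : Type*} [CommRing A] (d : DeltaStructure p A)

theorem frobeniusLift_apply (x : A) : d.frobeniusLift x = x ^ p + (p : A) * d.δ x := rfl

/-- The unique `δ`-structure on `ℤ`. -/
noncomputable def int (p : ℕ) [hp : Fact p.Prime] : DeltaStructure p ℤ :=
  ofFrobeniusLift p
    (fun _ h => (mul_eq_zero.mp h).resolve_left (Nat.cast_ne_zero.mpr hp.out.ne_zero))
    (RingHom.id ℤ) fun x => by
      rw [← (ZMod.intCast_zmod_eq_zero_iff_dvd _ p)]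
      simp

theorem δ_natCast (n : ℕ) : d.δ (n : A) = ((int p).δ n : ℤ) := by
  induction n with
  | zero => simp [δ_zero]
  | succ n ih =>
    have h := map_deltaCross p (Int.castRingHom A) n 1
    simp only [eq_intCast, Int.cast_natCast, Int.cast_one] at h
    push_cast
    rw [d.δ_add, (int p).δ_add, ih, d.δ_one, (int p).δ_one]
    push_cast
    rw [h]

end DeltaStructure

/-! ### Torsion-freeness of the cokernel of `φ - 1` -/

namespace DeltaStructure

theorem frobeniusLift_ofFrobeniusLift {p : ℕ} [Fact p.Prime] {A : Type*} [CommRing A]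
    (htf : ∀ x : A, (p : A) * x = 0 → x = 0) (φ : A →+* A)
    (hφ : ∀ x : A, (p : A) ∣ φ x - x ^ p) (x : A) :
    (ofFrobeniusLift p htf φ hφ).frobeniusLift x = φ x := by
  have h : φ x - x ^ p = p * (ofFrobeniusLift p htf φ hφ).δ x := (hφ x).choose_spec
  rw [frobeniusLift_apply, ← h]
  ring

variable {p : ℕ} [hp : Fact p.Prime] {A : Type*} [CommRing A] (d : DeltaStructure p A)

theorem δ_natCast_self : d.δ (p : A) = 1 - (p : A) ^ (p - 1) := by
  have h : (int p).δ p = 1 - (p : ℤ) ^ (p - 1) := by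
    have h1 : (int p).frobeniusLift p = p := frobeniusLift_ofFrobeniusLift _ _ _ _
    rw [frobeniusLift_apply] at h1
    have h3 : (p : ℤ) * (p : ℤ) ^ (p - 1) = (p : ℤ) ^ p := mul_pow_sub_one hp.out.ne_zero _
    apply mul_left_cancel₀ (Nat.cast_ne_zero.mpr hp.out.ne_zero : (p : ℤ) ≠ 0)
    linear_combination h1 + h3
  rw [δ_natCast, h]
  simp

theorem δ_natCast_mul (x : A) :
    d.δ (p * x) = d.frobeniusLift x - (p : A) ^ (p - 1) * x ^ p := by
  have h3 : (p : A) * (p : A) ^ (p - 1) = (p : A) ^ p := mul_pow_sub_one hp.out.ne_zero _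
  rw [d.δ_mul, δ_natCast_self, frobeniusLift_apply, ← h3]
  ring

/-- The Frobenius lift of a `δ`-ring commutes with `δ`. -/
theorem δ_frobeniusLift (x : A) : d.δ (d.frobeniusLift x) = d.frobeniusLift (d.δ x) := by
  rw [frobeniusLift_apply, d.δ_add, δ_natCast_mul, δ_pow]
  -- The identity cancels the term `p ^ (p - 1) δ(x) ^ p` coming from `δ(p δ(x))`.
  linear_combination mul_geom_sum₂_add_deltaCross p (x ^ p) (d.δ x)

theorem frobeniusLift_sub_mem (x : A) :
    d.frobeniusLift x - x ∈ Ideal.span (Set.range fun x : A => d.frobeniusLift x - x) :=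
  Ideal.subset_span ⟨x, rfl⟩

/-- On generators, `δ(φ(y)) = φ(δ(y))` gives `δ(φ(y) - y) = φ(δ(y)) - δ(y)` up to a cross term
divisible by `φ(y) - y`. -/
theorem δ_mem_span {x : A} (hx : x ∈ Ideal.span (Set.range fun x : A => d.frobeniusLift x - x)) :
    d.δ x ∈ Ideal.span (Set.range fun x : A => d.frobeniusLift x - x) := by
  induction hx using Submodule.span_induction with
  | mem x h =>
    obtain ⟨y, rfl⟩ := h
    have h1 := d.δ_add (d.frobeniusLift y - y) y
    rw [sub_add_cancel, δ_frobeniusLift] at h1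
    have h2 := deltaCross_mem p _ (d.frobeniusLift_sub_mem y) y
    have h3 := d.frobeniusLift_sub_mem (d.δ y)
    convert Ideal.sub_mem _ h3 h2 using 1
    linear_combination -h1
  | zero => simp [δ_zero]
  | add x y hx hy h1 h2 =>
    rw [d.δ_add]
    exact Ideal.add_mem _ (Ideal.add_mem _ h1 h2) (deltaCross_mem p _ hx y)
  | smul a x hx h =>
    rw [smul_eq_mul, d.δ_mul]
    exact Ideal.add_mem _ (Ideal.add_mem _ (Ideal.mul_mem_left _ _ h)
      (Ideal.mul_mem_left _ _ (Ideal.pow_mem_of_mem _ hx _ hp.out.pos))) (Ideal.mul_mem_left _ _ h)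

/-- The cokernel of `φ - 1` is `p`-torsion free. -/
theorem coker_torsionFree (x : d.Coker) (hx : (p : d.Coker) * x = 0) : x = 0 := by
  obtain ⟨x, rfl⟩ := Ideal.Quotient.mk_surjective x
  rw [← map_natCast (Ideal.Quotient.mk _), ← map_mul, Ideal.Quotient.eq_zero_iff_mem] at hx
  rw [Ideal.Quotient.eq_zero_iff_mem]
  have h1 := d.δ_mem_span hx
  rw [δ_natCast_mul] at h1
  -- As `p ≥ 2`, a factor `p x` splits off, so this term is in the ideal too.
  have h2 : (p : A) ^ (p - 1) * x ^ p = (p * x) * ((p : A) ^ (p - 2) * x ^ (p - 1)) := by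
    obtain ⟨k, hk⟩ := Nat.exists_eq_add_of_le hp.out.two_le
    have e1 : p - 1 = k + 1 := by omega
    have e2 : p - 2 = k := by omega
    have e3 : x ^ p = x ^ (k + 2) := by rw [hk, add_comm]
    rw [e1, e2, e3]
    ring
  have h3 := Ideal.mul_mem_right ((p : A) ^ (p - 2) * x ^ (p - 1)) _ hx
  rw [← h2] at h3
  have h4 := Ideal.sub_mem _ (Ideal.add_mem _ h1 h3) (d.frobeniusLift_sub_mem x)
  convert h4 using 1
  ring

theorem coker_dvd_pow_sub (x : d.Coker) : (p : d.Coker) ∣ x ^ p - x := by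
  obtain ⟨x, rfl⟩ := Ideal.Quotient.mk_surjective x
  refine ⟨-Ideal.Quotient.mk _ (d.δ x), ?_⟩
  have h := Ideal.Quotient.eq_zero_iff_mem.mpr (d.frobeniusLift_sub_mem x)
  rw [frobeniusLift_apply, map_sub, map_add, map_mul, map_pow, map_natCast] at h
  linear_combination h

theorem isDeltaHom_of_frobeniusLift {B : Type*} [CommRing B] {dA : DeltaStructure p A}
    {dB : DeltaStructure p B} (htf : ∀ x : B, (p : B) * x = 0 → x = 0) (f : A →+* B)
    (hf : ∀ x, f (dA.frobeniusLift x) = dB.frobeniusLift (f x)) : IsDeltaHom dA dB f := by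
  intro x
  have h := hf x
  simp only [frobeniusLift_apply, map_add, map_mul, map_pow, map_natCast] at h
  exact sub_eq_zero.mp (htf _ (by linear_combination h))

theorem IsDeltaHom.map_frobeniusLift {B : Type*} [CommRing B] {dA : DeltaStructure p A}
    {dB : DeltaStructure p B} {f : A →+* B} (hf : IsDeltaHom dA dB f) (x : A) :
    f (dA.frobeniusLift x) = dB.frobeniusLift (f x) := by
  simp [frobeniusLift_apply, hf x]

end DeltaStructure

/-! ### Arguments modulo `p` -/

/-- Dividing by `r` repeatedly puts `x` in every `(r ^ n)`. -/
theorem eq_zero_of_mul_closed {B : Type*} [CommRing B] (r : B) [IsHausdorff (Ideal.span {r}) B]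
    (P : B → Prop) (hP : ∀ x, P x → ∃ y, x = r * y ∧ P y) {x : B} (hx : P x) : x = 0 := by
  have key : ∀ n x, P x → r ^ n ∣ x := by
    intro n
    induction n with
    | zero => simp
    | succ n ih =>
      intro x hx
      obtain ⟨y, rfl, hy⟩ := hP x hx
      rw [pow_succ']
      exact mul_dvd_mul_left r (ih y hy)
  refine IsHausdorff.haus (I := Ideal.span {r}) inferInstance x fun n => ?_
  rw [SModEq.zero, smul_eq_mul, Ideal.mul_top, Ideal.span_singleton_pow,
    Ideal.mem_span_singleton]
  exact key n x hx

theorem surjective_of_surjective_mod {A B : Type*} [CommRing A] [CommRing B] (p : ℕ)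
    [IsPrecomplete (Ideal.span {(p : A)}) A] [IsHausdorff (Ideal.span {(p : B)}) B]
    (f : A →+* B) (h : ∀ b, ∃ a, (p : B) ∣ f a - b) : Function.Surjective f := by
  have hI : (Ideal.span {(p : A)}).map f = Ideal.span {(p : B)} := by
    rw [Ideal.map_span, Set.image_singleton, map_natCast]
  have : IsHausdorff ((Ideal.span {(p : A)}).map f) B := by rwa [hI]
  refine surjective_of_mk_map_comp_surjective (I := Ideal.span {(p : A)}) f fun b => ?_
  obtain ⟨b, rfl⟩ := Ideal.Quotient.mk_surjective b
  obtain ⟨a, ha⟩ := h b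
  refine ⟨a, ?_⟩
  rw [RingHom.comp_apply, Ideal.Quotient.eq, hI, Ideal.mem_span_singleton]
  exact ha

/-! ### Completion along a principal ideal -/

namespace AdicCompletion

theorem isAdicComplete_span {C : Type*} [CommRing C] (r : C) :
    IsAdicComplete (Ideal.span {algebraMap C (AdicCompletion (Ideal.span {r}) C) r})
      (AdicCompletion (Ideal.span {r}) C) := by
  have h := AdicCompletion.isAdicComplete (M := C) (Submodule.fg_span_singleton r)
  have e : (Ideal.span {r}).map (algebraMap C (AdicCompletion (Ideal.span {r}) C))
      = Ideal.span {algebraMap C (AdicCompletion (Ideal.span {r}) C) r} := by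
    rw [Ideal.map_span, Set.image_singleton]
  rw [← e]
  exact { toIsHausdorff := IsHausdorff.map_algebraMap_iff.mpr h.toIsHausdorff
          toIsPrecomplete := IsPrecomplete.map_algebraMap_iff.mpr h.toIsPrecomplete }

theorem dvd_iff_evalOneₐ_eq_zero {C : Type*} [CommRing C] (r : C)
    (x : AdicCompletion (Ideal.span {r}) C) :
    algebraMap C _ r ∣ x ↔ evalOneₐ (Ideal.span {r}) x = 0 := by
  rw [← Ideal.mem_span_singleton, ← Set.image_singleton, ← Ideal.map_span,
    ← ker_evalOneₐ_eq_map _ (Submodule.fg_span_singleton r)]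
  rfl

theorem exists_dvd_algebraMap_sub {C : Type*} [CommRing C] (r : C)
    (x : AdicCompletion (Ideal.span {r}) C) : ∃ c : C, algebraMap C _ r ∣ algebraMap C _ c - x := by
  obtain ⟨c, hc⟩ := Ideal.Quotient.mk_surjective (evalOneₐ (Ideal.span {r}) x)
  refine ⟨c, ?_⟩
  rw [dvd_iff_evalOneₐ_eq_zero, map_sub, ← hc]
  exact sub_self _

theorem torsionFree {C : Type*} [CommRing C] (r : C) (hr : ∀ c : C, r * c = 0 → c = 0)
    (x : AdicCompletion (Ideal.span {r}) C) (hx : algebraMap C _ r * x = 0) : x = 0 := by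
  induction x using AdicCompletion.induction_on with
  | _ a =>
    refine ext_evalₐ fun n => ?_
    -- One level higher, since cancelling `r` costs one power of `r`.
    have h := congrArg (evalₐ (Ideal.span {r}) (n + 1)) hx
    rw [map_mul, evalₐ_mk, AlgHom.commutes, _root_.map_zero] at h
    change Ideal.Quotient.mk _ r * _ = 0 at h
    rw [← map_mul, Ideal.Quotient.eq_zero_iff_mem, Ideal.span_singleton_pow,
      Ideal.mem_span_singleton, pow_succ'] at h
    obtain ⟨c, hc⟩ := h
    have h2 : a (n + 1) = r ^ n * c :=
      sub_eq_zero.mp (hr _ (by rw [mul_sub, hc]; ring))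
    have h3 := a.2 (Nat.le_succ n)
    rw [SModEq.sub_mem, smul_eq_mul, Ideal.mul_top] at h3
    rw [_root_.map_zero, evalₐ_mk, Ideal.Quotient.eq_zero_iff_mem]
    have h4 : a (n + 1) ∈ Ideal.span {r} ^ n := by
      rw [h2, Ideal.span_singleton_pow]
      exact Ideal.mul_mem_right _ _ (Ideal.mem_span_singleton_self _)
    simpa using Ideal.add_mem _ h3 h4

/-- Ring maps from `C` to a `p`-complete ring extend to the `p`-completion of `C`. -/
theorem exists_lift {C D : Type*} [CommRing C] [CommRing D] (p : ℕ)
    [IsAdicComplete (Ideal.span {(p : D)}) D] (f : C →+* D) :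
    ∃ g : AdicCompletion (Ideal.span {(p : C)}) C →+* D, g.comp (algebraMap C _) = f := by
  have hI (n : ℕ) : Ideal.span {(p : C)} ^ n ≤ (Ideal.span {(p : D)} ^ n).comap f := by
    rw [← Ideal.map_le_iff_le_comap, Ideal.map_pow, Ideal.map_span, Set.image_singleton,
      map_natCast]
  refine ⟨IsAdicComplete.liftRingHom (Ideal.span {(p : D)})
    (fun n => (Ideal.quotientMap _ f (hI n)).comp
      (evalₐ (Ideal.span {(p : C)}) n : _ →+* _)) ?_, ?_⟩
  · intro m n hle
    refine RingHom.ext fun x => ?_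
    induction x using AdicCompletion.induction_on with
    | _ a =>
      simp only [RingHom.comp_apply, RingHom.coe_coe, evalₐ_mk, Ideal.quotientMap_mk]
      change Ideal.Quotient.mk _ _ = _
      have h3 := a.2 hle
      rw [SModEq.sub_mem, smul_eq_mul, Ideal.mul_top] at h3
      rw [Ideal.Quotient.eq, ← neg_mem_iff, neg_sub, ← map_sub]
      exact hI m h3
  · refine RingHom.ext fun c => ?_
    refine (IsHausdorff.eq_iff_smodEq (I := Ideal.span {(p : D)})).mpr fun n => ?_
    rw [SModEq.sub_mem, smul_eq_mul, Ideal.mul_top, ← Ideal.Quotient.eq, RingHom.comp_apply,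
      IsAdicComplete.mk_liftRingHom, RingHom.comp_apply, RingHom.coe_coe, AlgHom.commutes]
    rfl

end AdicCompletion

/-! ### Vanishing of Tor for flat modules -/

section Tor

open Limits

theorem CategoryTheory.Functor.isZero_leftDerived_of_exact {C D : Type*} [Category* C] [Category* D]
    [Abelian C] [Abelian D] [HasProjectiveResolutions C] (F : C ⥤ D) [F.Additive]
    (hF : ∀ S : ShortComplex C, S.Exact → (S.map F).Exact) (X : C) (n : ℕ) :
    IsZero ((F.leftDerived (n + 1)).obj X) := by
  let P := CategoryTheory.projectiveResolution X
  refine IsZero.of_iso ?_ (P.isoLeftDerivedObj F (n + 1))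
  erw [← HomologicalComplex.exactAt_iff_isZero_homology]
  exact hF _ (P.complex_exactAt_succ n)

theorem ModuleCat.isZero_Tor_of_flat {R : Type u} [CommRing R] (M N : ModuleCat.{u} R)
    [Module.Flat R M] {n : ℕ} (hn : 0 < n) : IsZero (((Tor (ModuleCat.{u} R) n).obj M).obj N) := by
  obtain ⟨n, rfl⟩ := Nat.exists_eq_succ_of_ne_zero hn.ne'
  exact Functor.isZero_leftDerived_of_exact ((MonoidalCategory.tensoringLeft _).obj M)
    (fun S hS => Module.Flat.lTensor_shortComplex_exact M S hS) N n

end Tor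

/-! ### Ghost components and Dwork's lemma -/

namespace WittVector

variable {p : ℕ} [hp : Fact p.Prime] {B : Type*} [CommRing B]

theorem ghostComponent_eq_sum (w : WittVector p B) (n : ℕ) :
    ghostComponent n w = ∑ i ∈ Finset.range (n + 1), (p : B) ^ i * w.coeff i ^ p ^ (n - i) := by
  rw [ghostComponent_apply, aeval_wittPolynomial]

theorem ghostMap_injective_of_torsionFree (htf : ∀ x : B, (p : B) * x = 0 → x = 0) :
    Function.Injective (ghostMap : WittVector p B →+* ℕ → B) := by
  have htf' : ∀ n (x : B), (p : B) ^ n * x = 0 → x = 0 := by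
    intro n
    induction n with
    | zero => simp
    | succ n ih => exact fun x hx => ih x (htf _ (by rw [← mul_assoc, ← pow_succ', hx]))
  refine (injective_iff_map_eq_zero _).mpr fun w hw => WittVector.ext fun n => ?_
  rw [zero_coeff]
  induction n using Nat.strong_induction_on with
  | _ n ih =>
    have h : ghostComponent n w = 0 := congrFun hw n
    rw [ghostComponent_eq_sum, Finset.sum_range_succ, Finset.sum_eq_zero, zero_add, Nat.sub_self,
      pow_zero, pow_one] at h
    · exact htf' n _ h
    · intro i hi
      rw [Finset.mem_range] at hi
      rw [ih i hi, zero_pow (pow_pos hp.out.pos _).ne', mul_zero]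

variable (p) in
open Classical in
/-- The coordinates of the Witt vector all of whose ghost components are `x`. -/
noncomputable def constGhostCoeff (x : B) (n : ℕ) : B :=
  if h : (p : B) ^ n ∣ x - ∑ i : Fin n, (p : B) ^ (i : ℕ) * constGhostCoeff x i ^ p ^ (n - i)
  -- The value `0` is never reached once `x ^ p ≡ x` mod `p` throughout `B`.
  then h.choose else 0
termination_by n

omit hp in
theorem pow_mul_constGhostCoeff (x : B) (n : ℕ)
    (h : (p : B) ^ n ∣
      x - ∑ i ∈ Finset.range n, (p : B) ^ i * constGhostCoeff p x i ^ p ^ (n - i)) :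
    (p : B) ^ n * constGhostCoeff p x n
      = x - ∑ i ∈ Finset.range n, (p : B) ^ i * constGhostCoeff p x i ^ p ^ (n - i) := by
  have e := Fin.sum_univ_eq_sum_range
    (fun i => (p : B) ^ i * constGhostCoeff p x i ^ p ^ (n - i)) n
  rw [← e] at h ⊢
  rw [constGhostCoeff, dif_pos h]
  exact h.choose_spec.symm

/-- Dwork's lemma for constant sequences. -/
theorem ghostComponent_constGhostCoeff (hF : ∀ x : B, (p : B) ∣ x ^ p - x) (x : B) (n : ℕ) :
    ghostComponent n (WittVector.mk p (constGhostCoeff p x)) = x := by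
  induction n with
  | zero => simpa [ghostComponent_eq_sum] using pow_mul_constGhostCoeff (p := p) x 0 (by simp)
  | succ n ih =>
    have h : (p : B) ^ (n + 1) ∣ x - ∑ i ∈ Finset.range (n + 1),
        (p : B) ^ i * constGhostCoeff p x i ^ p ^ (n + 1 - i) := by
      -- Writing `x` as its `n`-th ghost component lets the two sums be compared term by term.
      nth_rewrite 1 [← ih]
      rw [ghostComponent_eq_sum, ← Finset.sum_sub_distrib]
      refine Finset.dvd_sum fun i hi => ?_
      rw [Finset.mem_range] at hi
      have e : n + 1 = i + (n - i + 1) := by omega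
      rw [← mul_sub]
      nth_rewrite 1 [e]
      rw [pow_add]
      refine mul_dvd_mul_left _ ?_
      have e2 : n + 1 - i = (n - i) + 1 := by omega
      rw [e2, pow_succ' p, pow_mul]
      -- Each `p`-th power improves a congruence by one factor `p`.
      refine dvd_sub_pow_of_dvd_sub ?_ _
      rw [← neg_sub]
      exact (hF _).neg_right
    rw [ghostComponent_eq_sum, Finset.sum_range_succ, Nat.sub_self, pow_zero, pow_one]
    change _ + _ * constGhostCoeff p x (n + 1) = x
    rw [pow_mul_constGhostCoeff x (n + 1) h]
    exact add_sub_cancel _ _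

/-- If `B` is `p`-torsion free and `x ^ p ≡ x` modulo `p` in `B`, there is a ring map `B → W(B)`
sending `x` to the Witt vector all of whose ghost components are `x`. -/
noncomputable def constGhost (htf : ∀ x : B, (p : B) * x = 0 → x = 0)
    (hF : ∀ x : B, (p : B) ∣ x ^ p - x) : B →+* WittVector p B :=
  have spec (x : B) : ghostMap (WittVector.mk p (constGhostCoeff p x)) = fun _ => x :=
    funext (ghostComponent_constGhostCoeff hF x)
  { toFun x := WittVector.mk p (constGhostCoeff p x)
    map_one' := ghostMap_injective_of_torsionFree htf (by rw [spec, map_one]; rfl)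
    map_zero' := ghostMap_injective_of_torsionFree htf (by rw [spec, map_zero]; rfl)
    map_add' x y := ghostMap_injective_of_torsionFree htf (by
      rw [map_add, spec, spec, spec]; rfl)
    map_mul' x y := ghostMap_injective_of_torsionFree htf (by
      rw [map_mul, spec, spec, spec]; rfl) }

theorem coeff_zero_constGhost (htf : ∀ x : B, (p : B) * x = 0 → x = 0)
    (hF : ∀ x : B, (p : B) ∣ x ^ p - x) (x : B) : (constGhost htf hF x).coeff 0 = x := by
  have h := ghostComponent_constGhostCoeff hF x 0
  rw [ghostComponent_eq_sum] at h
  simp only [zero_add, Finset.range_one, Finset.sum_singleton, pow_zero, one_mul, pow_one,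
    Nat.sub_self] at h
  exact h

end WittVector

/-! ### Witt vectors of `p`-Boolean algebras and Stone rings -/

namespace IsPBoolean

variable {p : ℕ} [hp : Fact p.Prime] {R : Type*} [CommRing R] (hR : IsPBoolean p R)
include hR

theorem witt_dvd_iff (w : WittVector p R) : (p : WittVector p R) ∣ w ↔ w.coeff 0 = 0 := by
  rcases subsingleton_or_nontrivial R with h | h
  · have h0 : w = 0 := WittVector.ext fun n => Subsingleton.elim _ _
    simp [h0]
  · obtain ⟨_, _⟩ := hR.charP_and_perfectRing
    rw [← Ideal.mem_span_singleton, WittVector.mem_span_p_iff_coeff_zero_eq_zero]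

theorem witt_isAdicComplete :
    IsAdicComplete (Ideal.span {(p : WittVector p R)}) (WittVector p R) := by
  rcases subsingleton_or_nontrivial R with h | h
  · have : Subsingleton (WittVector p R) :=
      ⟨fun x y => WittVector.ext fun n => Subsingleton.elim _ _⟩
    infer_instance
  · obtain ⟨_, _⟩ := hR.charP_and_perfectRing
    infer_instance

theorem frobenius_eq (w : WittVector p R) : WittVector.frobenius w = w := by
  rcases subsingleton_or_nontrivial R with h | h
  · exact WittVector.ext fun n => Subsingleton.elim _ _
  · obtain ⟨_, _⟩ := hR.charP_and_perfectRing
    ext n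
    rw [WittVector.coeff_frobenius_charP, hR.pow_eq]

theorem frobeniusLift_wittDelta (w : WittVector p R) : hR.wittDelta.frobeniusLift w = w :=
  (DeltaStructure.frobeniusLift_ofFrobeniusLift _ _ _ w).trans (hR.frobenius_eq w)

end IsPBoolean

namespace DeltaStructure

variable {p : ℕ} [hp : Fact p.Prime] {B : Type u} [CommRing B] {d : DeltaStructure p B}

theorem IsStone.frobeniusLift_eq (h : d.IsStone) (x : B) : d.frobeniusLift x = x := by
  obtain ⟨R, _, hR, e, he⟩ := h
  apply e.injective
  have h1 := he.map_frobeniusLift x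
  rwa [hR.frobeniusLift_wittDelta] at h1

theorem IsStone.torsionFree (h : d.IsStone) (x : B) (hx : (p : B) * x = 0) : x = 0 := by
  obtain ⟨R, _, hR, e, he⟩ := h
  have h1 := hR.witt_torsionFree (e x) (by rw [← map_natCast e, ← map_mul, hx, map_zero])
  exact (map_eq_zero_iff e e.injective).mp h1

theorem IsStone.isAdicComplete (h : d.IsStone) : IsAdicComplete (Ideal.span {(p : B)}) B := by
  obtain ⟨R, _, hR, e, he⟩ := h
  rw [← IsAdicComplete.congr_ringEquiv _ e, Ideal.map_span, Set.image_singleton]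
  have h : (e (p : B)) = p := map_natCast e p
  simpa [h] using hR.witt_isAdicComplete

/-- A `p`-complete `p`-torsion free `δ`-ring with `φ = 1` is Stone. -/
theorem isStone_of_torsionFree [IsAdicComplete (Ideal.span {(p : B)}) B]
    (htf : ∀ x : B, (p : B) * x = 0 → x = 0) (hφ : ∀ x, d.frobeniusLift x = x) : d.IsStone := by
  have hF (x : B) : (p : B) ∣ x ^ p - x :=
    ⟨-d.δ x, by linear_combination hφ x - d.frobeniusLift_apply x⟩
  let I := Ideal.span {(p : B)}
  have hR : IsPBoolean p (B ⧸ I) := by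
    constructor
    · rw [← map_natCast (Ideal.Quotient.mk I), Ideal.Quotient.eq_zero_iff_mem]
      exact Ideal.mem_span_singleton_self _
    · intro a
      obtain ⟨a, rfl⟩ := Ideal.Quotient.mk_surjective a
      rw [← map_pow, Ideal.Quotient.eq]
      exact Ideal.mem_span_singleton.mpr (hF a)
  let θ : B →+* WittVector p (B ⧸ I) :=
    (WittVector.map (Ideal.Quotient.mk I)).comp (WittVector.constGhost htf hF)
  have hθ (x : B) : (θ x).coeff 0 = Ideal.Quotient.mk I x :=
    (WittVector.map_coeff _ _ _).trans
      (congrArg _ (WittVector.coeff_zero_constGhost htf hF x))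
  have hinj : Function.Injective θ := by
    refine (injective_iff_map_eq_zero θ).mpr fun x hx => ?_
    -- If `θ x = 0`, its coordinate `0` shows `x = p y`, and `θ y = 0` because the target is
    -- torsion-free.
    refine eq_zero_of_mul_closed (p : B) (fun x => θ x = 0) (fun x hx => ?_) hx
    have h0 := hθ x
    rw [hx, WittVector.zero_coeff, eq_comm, Ideal.Quotient.eq_zero_iff_mem,
      Ideal.mem_span_singleton] at h0
    obtain ⟨y, rfl⟩ := h0
    exact ⟨y, rfl, hR.witt_torsionFree _ (by rw [← hx, map_mul, map_natCast])⟩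
  have hsurj : Function.Surjective θ := by
    have := hR.witt_isAdicComplete
    refine surjective_of_surjective_mod p θ fun w => ?_
    obtain ⟨x, hx⟩ := Ideal.Quotient.mk_surjective (w.coeff 0)
    refine ⟨x, ?_⟩
    rw [hR.witt_dvd_iff]
    change WittVector.constantCoeff (θ x - w) = 0
    rw [map_sub]
    exact sub_eq_zero.mpr ((hθ x).trans hx)
  refine ⟨B ⧸ I, inferInstance, hR, RingEquiv.ofBijective θ ⟨hinj, hsurj⟩, ?_⟩
  refine isDeltaHom_of_frobeniusLift hR.witt_torsionFree _ fun x => ?_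
  rw [hφ, hR.frobeniusLift_wittDelta]

end DeltaStructure

theorem isCompletelyFaithfullyFlat_of_bijective {A B : Type u} [CommRing A] [CommRing B]
    (I : Ideal A) (f : A →+* B) (hf : Function.Bijective f) : IsCompletelyFaithfullyFlat I f := by
  let _ : Algebra A B := f.toAlgebra
  refine ⟨fun i hi => ?_, RingHom.FaithfullyFlat.of_bijective ⟨?_, ?_⟩⟩
  · have : Module.Flat A B := Module.Flat.of_linearEquiv
      (LinearEquiv.ofBijective (Algebra.linearMap A B) hf).symm
    exact ModuleCat.isZero_Tor_of_flat _ _ hi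
  · refine Ideal.quotientMap_injective' (le_of_eq ?_)
    exact Ideal.comap_map_of_bijective f hf
  · exact Ideal.quotientMap_surjective hf.2

/-! ### The completed coinvariants -/

namespace DeltaStructure

variable {p : ℕ} [hp : Fact p.Prime] {A : Type u} [CommRing A] (d : DeltaStructure p A)

theorem algebraMap_natCast_coinvariants :
    algebraMap d.Coker d.Coinvariants (p : d.Coker) = (p : d.Coinvariants) := map_natCast _ p

theorem coinvariants_torsionFree (x : d.Coinvariants) (hx : (p : d.Coinvariants) * x = 0) :
    x = 0 :=
  AdicCompletion.torsionFree (p : d.Coker) d.coker_torsionFree x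
    (by rw [algebraMap_natCast_coinvariants, hx])

theorem coinvariants_isAdicComplete :
    IsAdicComplete (Ideal.span {(p : d.Coinvariants)}) d.Coinvariants := by
  have h := AdicCompletion.isAdicComplete_span (p : d.Coker)
  rwa [algebraMap_natCast_coinvariants] at h

theorem coinvariants_dvd (x : d.Coinvariants) : (p : d.Coinvariants) ∣ x - x ^ p := by
  have h := AdicCompletion.dvd_iff_evalOneₐ_eq_zero (p : d.Coker) (x - x ^ p)
  rw [algebraMap_natCast_coinvariants] at h
  rw [h, map_sub, map_pow]
  obtain ⟨c, hc⟩ := Ideal.Quotient.mk_surjective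
    (AdicCompletion.evalOneₐ (Ideal.span {(p : d.Coker)}) x)
  rw [← hc, ← map_pow, sub_eq_zero, eq_comm, Ideal.Quotient.eq, Ideal.mem_span_singleton]
  exact d.coker_dvd_pow_sub c

theorem exists_dvd_toCoinvariants_sub (x : d.Coinvariants) :
    ∃ a : A, (p : d.Coinvariants) ∣ d.toCoinvariants a - x := by
  obtain ⟨c, hc⟩ := AdicCompletion.exists_dvd_algebraMap_sub (p : d.Coker) x
  obtain ⟨a, rfl⟩ := Ideal.Quotient.mk_surjective c
  rw [algebraMap_natCast_coinvariants] at hc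
  exact ⟨a, hc⟩

theorem toCoinvariants_frobeniusLift (x : A) :
    d.toCoinvariants (d.frobeniusLift x) = d.toCoinvariants x :=
  congrArg (algebraMap d.Coker d.Coinvariants)
    (Ideal.Quotient.eq.mpr (d.frobeniusLift_sub_mem x))

/-- The `δ`-structure with `φ = 1` on the completed coinvariants. -/
noncomputable def coinvariantsDelta : DeltaStructure p d.Coinvariants :=
  ofFrobeniusLift p d.coinvariants_torsionFree (RingHom.id _) d.coinvariants_dvd

theorem frobeniusLift_coinvariantsDelta (x : d.Coinvariants) :
    d.coinvariantsDelta.frobeniusLift x = x :=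
  frobeniusLift_ofFrobeniusLift _ _ _ x

theorem isStone_coinvariantsDelta : d.coinvariantsDelta.IsStone := by
  have := d.coinvariants_isAdicComplete
  exact isStone_of_torsionFree d.coinvariants_torsionFree d.frobeniusLift_coinvariantsDelta

theorem isDeltaHom_toCoinvariants : IsDeltaHom d d.coinvariantsDelta d.toCoinvariants :=
  isDeltaHom_of_frobeniusLift d.coinvariants_torsionFree _ fun x => by
    rw [frobeniusLift_coinvariantsDelta, toCoinvariants_frobeniusLift]

/-- As `η` is surjective modulo `p`, each difference `g x - g' x` is `p` times another such
difference. -/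
theorem coinvariants_hom_ext {C : Type*} [CommRing C] [IsHausdorff (Ideal.span {(p : C)}) C]
    {g g' : d.Coinvariants →+* C} (h : g.comp d.toCoinvariants = g'.comp d.toCoinvariants) :
    g = g' := by
  refine RingHom.ext fun x => sub_eq_zero.mp ?_
  refine eq_zero_of_mul_closed (p : C) (fun c => ∃ x, c = g x - g' x) ?_ ⟨x, rfl⟩
  rintro _ ⟨x, rfl⟩
  obtain ⟨a, y, hy⟩ := d.exists_dvd_toCoinvariants_sub x
  refine ⟨_, ?_, -y, rfl⟩
  have h1 : g (d.toCoinvariants a) = g' (d.toCoinvariants a) := RingHom.congr_fun h a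
  rw [sub_eq_iff_eq_add] at hy
  have h2 := congrArg g hy
  have h3 := congrArg g' hy
  simp only [map_add, map_mul, map_natCast, map_neg] at h2 h3 ⊢
  linear_combination h1 - h2 + h3

theorem isStoneReflection_toCoinvariants :
    IsStoneReflection d d.coinvariantsDelta d.toCoinvariants where
  stone := d.isStone_coinvariantsDelta
  isDeltaHom := d.isDeltaHom_toCoinvariants
  existsUnique C _ dC hC f hf := by
    have := hC.isAdicComplete
    have hker : ∀ x ∈ Ideal.span (Set.range fun x : A => d.frobeniusLift x - x), f x = 0 := by
      suffices h : Ideal.span (Set.range fun x : A => d.frobeniusLift x - x) ≤ RingHom.ker f from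
        fun x hx => h hx
      rw [Ideal.span_le]
      rintro _ ⟨x, rfl⟩
      change f (d.frobeniusLift x - x) = 0
      rw [map_sub, hf.map_frobeniusLift, hC.frobeniusLift_eq, sub_self]
    obtain ⟨g, hg⟩ := AdicCompletion.exists_lift p (Ideal.Quotient.lift _ f hker)
    have hgf : g.comp d.toCoinvariants = f := by
      rw [toCoinvariants, ← RingHom.comp_assoc, hg]
      exact Ideal.Quotient.lift_comp_mk _ _ hker
    refine ⟨g, ⟨?_, hgf⟩, fun g' hg' => d.coinvariants_hom_ext (hg'.2.trans hgf.symm)⟩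
    exact isDeltaHom_of_frobeniusLift hC.torsionFree g fun x => by
      rw [frobeniusLift_coinvariantsDelta, hC.frobeniusLift_eq]

/-- The inverse is the factorization of the identity of `A` through `η`. -/
theorem IsStone.bijective_toCoinvariants {d : DeltaStructure p A} (h : d.IsStone) :
    Function.Bijective d.toCoinvariants := by
  have hA := h.isAdicComplete
  have hB := d.coinvariants_isAdicComplete
  have hA1 := d.isStoneReflection_toCoinvariants
  obtain ⟨g, ⟨-, hg⟩, -⟩ := hA1.existsUnique A d h (RingHom.id A) fun _ => rfl
  have hg' : d.toCoinvariants.comp g = RingHom.id _ :=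
    d.coinvariants_hom_ext (by rw [RingHom.comp_assoc, hg]; rfl)
  exact ⟨Function.LeftInverse.injective (RingHom.congr_fun hg),
    Function.RightInverse.surjective (RingHom.congr_fun hg')⟩

theorem isStone_of_bijective_toCoinvariants [IsAdicComplete (Ideal.span {(p : A)}) A]
    (h : Function.Bijective d.toCoinvariants) : d.IsStone := by
  refine isStone_of_torsionFree (fun x hx => ?_)
    fun x => h.1 (d.toCoinvariants_frobeniusLift x)
  refine (map_eq_zero_iff _ h.1).mp (d.coinvariants_torsionFree _ ?_)
  rw [← map_natCast d.toCoinvariants, ← map_mul, hx, map_zero]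

theorem bijective_toCoinvariants_of_faithfullyFlat [IsAdicComplete (Ideal.span {(p : A)}) A]
    (h : IsCompletelyFaithfullyFlat (Ideal.span {(p : A)}) d.toCoinvariants) :
    Function.Bijective d.toCoinvariants := by
  have hB := d.coinvariants_isAdicComplete
  refine ⟨(injective_iff_map_eq_zero _).mpr fun x hx => ?_,
    surjective_of_surjective_mod p _ d.exists_dvd_toCoinvariants_sub⟩
  refine eq_zero_of_mul_closed (p : A) (fun x => d.toCoinvariants x = 0) (fun x hx => ?_) hx
  have hmk : Ideal.Quotient.mk (Ideal.span {(p : A)}) x = 0 := by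
    refine (injective_iff_map_eq_zero _).mp h.2.injective _ ?_
    rw [Ideal.quotientMap_mk, hx, map_zero]
  rw [Ideal.Quotient.eq_zero_iff_mem, Ideal.mem_span_singleton] at hmk
  obtain ⟨y, rfl⟩ := hmk
  exact ⟨y, rfl, d.coinvariants_torsionFree _
    (by rw [← hx, map_mul, map_natCast])⟩

end DeltaStructure

theorem mainTheorem6 (p : ℕ) [Fact p.Prime] {A : Type u} [CommRing A] (d : DeltaStructure p A)
    [IsAdicComplete (Ideal.span {(p : A)}) A] :
    (∃ dB : DeltaStructure p d.Coinvariants,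
      DeltaStructure.IsStoneReflection d dB d.toCoinvariants) ∧
    (d.IsStone ↔ IsCompletelyFaithfullyFlat (Ideal.span {(p : A)}) d.toCoinvariants) :=
  ⟨⟨_, d.isStoneReflection_toCoinvariants⟩,
    fun h => isCompletelyFaithfullyFlat_of_bijective _ _ h.bijective_toCoinvariants,
    fun h => d.isStone_of_bijective_toCoinvariants
      (d.bijective_toCoinvariants_of_faithfullyFlat h)⟩
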